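/- Let $\Lambda\subset\mathbb Z$ be a finite non-empty set with $-\Lambda=\Lambda$, let $S=\{z\in\mathbb C:|z|=1\}$, and let $V_\Lambda$ be the real vector space of real Laurent polynomials with spectrum $\Lambda$, i.e. of the functions $f(z)=\sum_{m\in\Lambda}a_mz^m$ on $\mathbb C\setminus\{0\}$, $a_m\in\mathbb C$, whose values on $S$ are real. Equip $V_\Lambda$ with the scalar product $(f,g)=\frac1{2\pi}\int_0^{2\pi}f(e^{i\theta})g(e^{i\theta})\,d\theta$, and let $f_\Lambda$ be a random element of $V_\Lambda$ distributed according to the standard normal distribution of this Euclidean space. A root of $f$ is a point $z\in\mathbb C\setminus\{0\}$ with $f(z)=0$; a real root is a root lying on $S$. Put $\deg(f_\Lambda)=\max_{\lambda\in\Lambda}|\lambda|$. If $\Lambda\neq\{0\}$, let $\mathcal P(\Lambda)$ be the probability that a root of $f_\Lambda$ is real, i.e. the expectation of the ratio (number of real roots of $f_\Lambda$)/(number of roots of $f_\Lambda$). Then: (a) the number of real roots of $f_\Lambda$ is integrable, and its expectation is $$2\sqrt{\frac1{\#\Lambda}\sum_{\lambda\in\Lambda}\lambda^2}\,;$$ (b)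 if $\Lambda\ne\{0\}$, then $$\mathcal P(\Lambda)=\frac1{\deg(f_\Lambda)}\sqrt{\frac1{\#\Lambda}\sum_{\lambda\in\Lambda}\lambda^2}\,;$$ (c) if $\Lambda\ne\{0\}$, then $\mathcal P(k\Lambda)=\mathcal P(\Lambda)$ for every integer $k\neq0$. -/

import Mathlib

open MeasureTheory ProbabilityTheory
open scoped LaurentPolynomial Real

noncomputable section

namespace RandomLaurent

/-- The value `P(z)` of a complex Laurent polynomial at a point `z ∈ ℂ ∖ {0}`. -/
def value (P : ℂ[T;T⁻¹]) (z : ℂˣ) : ℂ :=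
  LaurentPolynomial.eval₂ (RingHom.id ℂ) z P

lemma value_add (P Q : ℂ[T;T⁻¹]) (z : ℂˣ) : value (P + Q) z = value P z + value Q z :=
  map_add _ _ _

lemma value_smul (c : ℝ) (P : ℂ[T;T⁻¹]) (z : ℂˣ) : value (c • P) z = c * value P z := by
  have h : c • P = LaurentPolynomial.C (c : ℂ) * P := by
    rw [← LaurentPolynomial.smul_eq_C_mul]
    ext n
    simp
  rw [h, value, map_mul, LaurentPolynomial.eval₂_C]
  rfl

/-- The real vector space of real Laurent polynomials with spectrum `Λ`: the Laurent polynomials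
`∑_{m ∈ Λ} a_m z^m` with complex coefficients whose values on the unit circle are real. -/
def realLaurent (Λ : Finset ℤ) : Submodule ℝ ℂ[T;T⁻¹] where
  carrier := {P | (∀ m : ℤ, m ∉ Λ → P.coeff m = 0) ∧
    ∀ z : ℂˣ, ‖(z : ℂ)‖ = 1 → (value P z).im = 0}
  add_mem' := by
    rintro P Q ⟨hP, hP'⟩ ⟨hQ, hQ'⟩
    refine ⟨fun m hm => ?_, fun z hz => ?_⟩
    · simp [hP m hm, hQ m hm]
    · simp [value_add, hP' z hz, hQ' z hz]
  zero_mem' := ⟨fun m _ => by simp, fun z _ => by simp [value]⟩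
  smul_mem' := by
    rintro c P ⟨hP, hP'⟩
    refine ⟨fun m hm => ?_, fun z hz => ?_⟩
    · simp [hP m hm]
    · simp [value_smul, hP' z hz]

/-- The trigonometric polynomial `θ ↦ P(e^{iθ})` given by the restriction of a real Laurent
polynomial `P` to the unit circle (these values are real, so nothing is lost by `re`). -/
def trig {Λ : Finset ℤ} (P : realLaurent Λ) (θ : ℝ) : ℝ :=
  (value P (Circle.toUnits (Circle.exp θ))).re

lemma trig_add {Λ : Finset ℤ} (P Q : realLaurent Λ) (θ : ℝ) :
    trig (P + Q) θ = trig P θ + trig Q θ := by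
  simp [trig, value_add]

lemma trig_smul {Λ : Finset ℤ} (c : ℝ) (P : realLaurent Λ) (θ : ℝ) :
    trig (c • P) θ = c * trig P θ := by
  simp [trig, value_smul]

lemma continuous_value_circle (P : ℂ[T;T⁻¹]) :
    Continuous fun θ : ℝ => value P (Circle.toUnits (Circle.exp θ)) := by
  induction P using LaurentPolynomial.induction_on' with
  | add P Q hP hQ =>
    simp only [value_add]
    exact hP.add hQ
  | C_mul_T n a =>
    simp only [value, LaurentPolynomial.eval₂_C_mul_T, Units.val_zpow_eq_zpow_val,
      Circle.toUnits_apply, Units.val_mk0]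
    exact continuous_const.mul ((continuous_subtype_val.comp Circle.exp.continuous).zpow₀ n
      fun θ => Or.inl (Circle.coe_ne_zero _))

lemma continuous_trig {Λ : Finset ℤ} (P : realLaurent Λ) : Continuous (trig P) :=
  Complex.continuous_re.comp (continuous_value_circle P)

/-- A Laurent polynomial with infinitely many roots vanishes. -/
lemma eq_zero_of_infinite (P : ℂ[T;T⁻¹]) (h : {z : ℂˣ | value P z = 0}.Infinite) : P = 0 := by
  obtain ⟨n, p, hp⟩ := P.exists_T_pow
  have hp0 : p = 0 := by
    refine Polynomial.eq_zero_of_infinite_isRoot p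
      ((h.image (Units.val_injective.injOn)).mono ?_)
    rintro _ ⟨z, hz, rfl⟩
    have h1 := congrArg (LaurentPolynomial.eval₂ (RingHom.id ℂ) z) hp
    rw [LaurentPolynomial.eval₂_toLaurent, map_mul] at h1
    have h2 : LaurentPolynomial.eval₂ (RingHom.id ℂ) z P = 0 := hz
    rw [h2, zero_mul] at h1
    exact h1
  rw [hp0, map_zero] at hp
  exact ((LaurentPolynomial.isUnit_T (R := ℂ) (n : ℤ)).mul_left_eq_zero).1 hp.symm

lemma eq_zero_of_trig {Λ : Finset ℤ} (P : realLaurent Λ)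
    (h : ∀ θ ∈ Set.Ioo (0 : ℝ) (2 * π), trig P θ = 0) : P = 0 := by
  apply Subtype.ext
  refine eq_zero_of_infinite _ ?_
  have hinj : Set.InjOn (fun θ : ℝ => Circle.toUnits (Circle.exp θ)) (Set.Ioo 0 π) := by
    intro x hx y hy hxy
    have h1 : ((Circle.exp x : Circle) : ℂ) = Circle.exp y := congrArg Units.val hxy
    rw [← Circle.arg_exp (by linarith [hx.1, Real.pi_pos]) hx.2.le, h1,
      Circle.arg_exp (by linarith [hy.1, Real.pi_pos]) hy.2.le]
  refine ((Set.Ioo_infinite Real.pi_pos).image hinj).mono ?_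
  rintro _ ⟨θ, hθ, rfl⟩
  refine Complex.ext (h θ ⟨hθ.1, by linarith [hθ.2, Real.pi_pos]⟩) (P.2.2 _ ?_)
  simp

/-- The scalar product `(f, g) = (1 / 2π) ∫_S f g` of `L₂(S)`. -/
@[reducible] def innerCore (Λ : Finset ℤ) : InnerProductSpace.Core ℝ (realLaurent Λ) where
  inner P Q := (1 / (2 * π)) * ∫ θ in (0 : ℝ)..(2 * π), trig P θ * trig Q θ
  conj_inner_symm P Q := by
    simp [mul_comm]
  re_inner_nonneg P := by
    have h : 0 ≤ ∫ θ in (0 : ℝ)..(2 * π), trig P θ * trig P θ :=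
      intervalIntegral.integral_nonneg (by positivity) fun θ _ => mul_self_nonneg _
    simp only [RCLike.re_to_real]
    positivity
  add_left P Q R := by
    have hi : ∀ A B : realLaurent Λ, IntervalIntegrable (fun θ => trig A θ * trig B θ)
        volume 0 (2 * π) := fun A B =>
      ((continuous_trig A).mul (continuous_trig B)).intervalIntegrable _ _
    simp only [trig_add, add_mul]
    rw [intervalIntegral.integral_add (hi P R) (hi Q R)]
    ring
  smul_left P Q c := by
    simp only [trig_smul, mul_assoc, intervalIntegral.integral_const_mul, conj_trivial]
    ring
  definite P h := by
    apply eq_zero_of_trig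
    by_contra! hne
    obtain ⟨θ, hθ, hθ0⟩ := hne
    have hpos : 0 < ∫ θ in (0 : ℝ)..(2 * π), trig P θ * trig P θ :=
      intervalIntegral.integral_pos (by positivity)
        ((continuous_trig P).mul (continuous_trig P)).continuousOn
        (fun _ _ => mul_self_nonneg _)
        ⟨θ, Set.Ioo_subset_Icc_self hθ, mul_self_pos.2 hθ0⟩
    have : 0 < (1 / (2 * π)) * ∫ θ in (0 : ℝ)..(2 * π), trig P θ * trig P θ := by positivity
    exact this.ne' h

instance normedInst (Λ : Finset ℤ) : NormedAddCommGroup (realLaurent Λ) :=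
  (innerCore Λ).toNormedAddCommGroup

instance innerInst (Λ : Finset ℤ) : InnerProductSpace ℝ (realLaurent Λ) :=
  InnerProductSpace.ofCore (innerCore Λ).toCore

instance finiteDimInst (Λ : Finset ℤ) : FiniteDimensional ℝ (realLaurent Λ) := by
  let L : realLaurent Λ →ₗ[ℝ] (Λ → ℂ) :=
    { toFun := fun P m => (P : ℂ[T;T⁻¹]).coeff m
      map_add' := fun P Q => by ext m; simp
      map_smul' := fun c P => by ext m; simp }
  refine FiniteDimensional.of_injective L fun P Q h => ?_
  apply Subtype.ext
  ext m
  by_cases hm : m ∈ Λ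
  · exact congrFun h ⟨m, hm⟩
  · rw [P.2.1 m hm, Q.2.1 m hm]

instance measurableInst (Λ : Finset ℤ) : MeasurableSpace (realLaurent Λ) := borel _

instance borelInst (Λ : Finset ℤ) : BorelSpace (realLaurent Λ) := ⟨rfl⟩

/-- The law of a random real Laurent polynomial with spectrum `Λ`: the standard normal distribution
of the Euclidean space `realLaurent Λ` with the metric of `L₂(S)`. -/
def law (Λ : Finset ℤ) : Measure (realLaurent Λ) := stdGaussian (realLaurent Λ)

/-- The roots of a Laurent polynomial in `ℂ ∖ {0}`. -/
def roots (P : ℂ[T;T⁻¹]) : Set ℂˣ := {z | value P z = 0}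

/-- The real roots of a Laurent polynomial: its roots on the unit circle. -/
def realRoots (P : ℂ[T;T⁻¹]) : Set ℂˣ := {z | z ∈ roots P ∧ ‖(z : ℂ)‖ = 1}

/-- The number of real roots. -/
def numRealRoots {Λ : Finset ℤ} (P : realLaurent Λ) : ℝ := (realRoots P).ncard

/-- The probability that a root of a random real Laurent polynomial with spectrum `Λ` is real:
the polynomial is drawn from `law Λ`, then a root is drawn uniformly from its finite set of roots,
so this is the expectation of the proportion of real roots among all roots. -/
def probRootReal (Λ : Finset ℤ) : ℝ :=
  ∫ P : realLaurent Λ, numRealRoots P / ((roots (P : ℂ[T;T⁻¹])).ncard : ℝ) ∂(law Λ)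

/-- The degree `max_{k ∈ Λ} |k|` of a real Laurent polynomial with spectrum `Λ`. -/
def degree (Λ : Finset ℤ) : ℕ := Λ.sup Int.natAbs

end RandomLaurent

end

/-! The count of real roots is a count of sign changes, and sign changes are governed by angles. By
the reproducing kernel, evaluation at `e^{it}` is the scalar product with `evalVec t`, a vector of
constant length `√#Λ`. By rotation invariance of the Gaussian, two such evaluations have opposite
signs with probability `angle / π` (`stdGaussian_inner_mul_inner_neg`). The angle depends only on `s
- t` (`angle_evalVec`), so the expected number of sign changes on a grid of `n` equal arcs is `n`
times a single angle over `π`. As `n → ∞` this tends to `1/π` times the length of the normalised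
curve `evalVec`, which has constant speed `√((1/#Λ) ∑ λ²)`; the length is `2π` times this speed.

Almost surely the count of sign changes equals the number of real roots for all large `n`: roots are
simple (`law_multipleRoot`), no grid point is a root (`law_trig_eq_zero`), and a simple zero forces
a sign change (`eventually_le_signChanges`). The bound by `2 * degree Λ` permits dominated
convergence. Since the total number of roots is almost surely exactly `2 * degree Λ`, the proportion
of real roots has a deterministic denominator.

All exceptional sets are shown null in the same way: along a well-chosen direction every parallel
line meets them in a countable set (`stdGaussian_eq_zero_of_lines`). -/

noncomputable section

namespace RandomLaurent

open Filter Topology ComplexConjugate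
open scoped RealInnerProductSpace ENNReal

/-! ### Standard Gaussian measures: null sets along lines, and the law of sign disagreement -/

section Gaussian

variable {E : Type*} [NormedAddCommGroup E] [InnerProductSpace ℝ E] [FiniteDimensional ℝ E]
  [MeasurableSpace E] [BorelSpace E]

/-- The standard Gaussian measure is the convolution of its projection to the orthogonal complement
of a unit vector `e` and the standard Gaussian measure of the line spanned by `e`. -/
lemma stdGaussian_eq_conv (e : E) (he : ‖e‖ = 1) :
    stdGaussian E = ((stdGaussian E).map fun x => x - ⟪e, x⟫ • e) ∗
      ((gaussianReal 0 1).map fun t : ℝ => t • e) := by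
  have hm₁ : Measurable fun x : E => x - ⟪e, x⟫ • e := by fun_prop
  have hm₂ : Measurable fun t : ℝ => t • e := by fun_prop
  have := Measure.isProbabilityMeasure_map (μ := stdGaussian E) hm₁.aemeasurable
  have := Measure.isProbabilityMeasure_map (μ := gaussianReal 0 1) hm₂.aemeasurable
  apply Measure.ext_of_charFun
  ext s
  have h₁ : charFun ((stdGaussian E).map fun x => x - ⟪e, x⟫ • e) s =
      charFun (stdGaussian E) (s - ⟪e, s⟫ • e) := by
    rw [charFun_apply, charFun_apply, integral_map hm₁.aemeasurable (by fun_prop)]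
    congr 1 with x
    rw [inner_sub_left, inner_sub_right, real_inner_smul_left, real_inner_smul_right,
      real_inner_comm e x, mul_comm ⟪e, x⟫]
  have h₂ : charFun ((gaussianReal 0 1).map fun t : ℝ => t • e) s =
      charFun (gaussianReal 0 1) ⟪e, s⟫ := by
    rw [charFun_apply, charFun_apply, integral_map hm₂.aemeasurable (by fun_prop)]
    congr 1 with t
    rw [real_inner_smul_left]
    simp [mul_comm]
  -- Pythagoras splits the exponent `-‖s‖²/2`, so the two characteristic functions multiply to the
  -- Gaussian one.
  have h₃ : ‖s - ⟪e, s⟫ • e‖ ^ 2 = ‖s‖ ^ 2 - ⟪e, s⟫ ^ 2 := by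
    rw [norm_sub_sq_real, real_inner_smul_right, norm_smul, he, real_inner_comm]
    simp only [Real.norm_eq_abs, mul_one, sq_abs]
    ring
  rw [charFun_conv, h₁, h₂, charFun_stdGaussian, charFun_stdGaussian, charFun_gaussianReal,
    ← Complex.exp_add]
  congr 1
  have h₄ : (‖s - ⟪e, s⟫ • e‖ : ℂ) ^ 2 = (‖s‖ : ℂ) ^ 2 - (⟪e, s⟫ : ℂ) ^ 2 := by exact_mod_cast h₃
  rw [h₄]
  simp
  ring

/-- A measurable set meeting every line of a given direction in a countable set is a null set of
the standard Gaussian measure. -/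
lemma stdGaussian_eq_zero_of_lines {B : Set E} (hB : MeasurableSet B) {h : E} (hh : h ≠ 0)
    (hc : ∀ g : E, {t : ℝ | g + t • h ∈ B}.Countable) : stdGaussian E B = 0 := by
  have hh' : ‖h‖ ≠ 0 := norm_ne_zero_iff.2 hh
  set e : E := ‖h‖⁻¹ • h with he
  have he1 : ‖e‖ = 1 := by rw [he, norm_smul, norm_inv, norm_norm, inv_mul_cancel₀ hh']
  have hm₂ : Measurable fun t : ℝ => t • e := by fun_prop
  have := Measure.isProbabilityMeasure_map (μ := gaussianReal 0 1) hm₂.aemeasurable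
  have hna : NullSingletonClass (gaussianReal 0 1) := nullSingletonClass_gaussianReal one_ne_zero
  have hB' : MeasurableSet ((fun x : E × E => x.1 + x.2) ⁻¹' B) := hB.preimage (by fun_prop)
  rw [stdGaussian_eq_conv e he1, Measure.conv, Measure.map_apply (by fun_prop) hB,
    Measure.prod_apply hB']
  -- Fubini: each fibre is a countable set of the line through `g`, and the one-dimensional Gaussian
  -- has no atoms.
  refine lintegral_eq_zero_of_ae_eq_zero (Eventually.of_forall fun g => ?_)
  beta_reduce
  rw [Measure.map_apply hm₂ (measurable_prodMk_left hB')]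
  refine Set.Countable.measure_zero ?_ _
  have : (fun t : ℝ => t • e) ⁻¹' (Prod.mk g ⁻¹' ((fun x : E × E => x.1 + x.2) ⁻¹' B)) =
      (fun t : ℝ => t * ‖h‖⁻¹) ⁻¹' {t : ℝ | g + t • h ∈ B} := by
    ext t
    simp [he, smul_smul]
  rw [this]
  exact (hc g).preimage (mul_left_injective₀ (inv_ne_zero hh'))

/-- The planar standard Gaussian measure of a measurable cone is proportional to its angle. -/
lemma gaussianReal_prod_cone {A : Set (ℝ × ℝ)} (hA : MeasurableSet A) {Θ : Set ℝ}
    (hΘ : MeasurableSet Θ)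
    (h : ∀ r > 0, ∀ θ ∈ Set.Ioo (-π) π, (r * Real.cos θ, r * Real.sin θ) ∈ A ↔ θ ∈ Θ) :
    ((gaussianReal 0 1).prod (gaussianReal 0 1)) A =
      volume (Θ ∩ Set.Ioo (-π) π) / ENNReal.ofReal (2 * π) := by
  set D : ℝ → ℝ≥0∞ := fun r => ENNReal.ofReal r *
    ENNReal.ofReal ((√(2 * π))⁻¹ * (√(2 * π))⁻¹ * Real.exp (-(r ^ 2) / 2)) with hD
  have hDm : Measurable D := by fun_prop
  have key : ∀ {A : Set (ℝ × ℝ)}, MeasurableSet A → ∀ {Θ : Set ℝ}, MeasurableSet Θ →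
      (∀ r > 0, ∀ θ ∈ Set.Ioo (-π) π, (r * Real.cos θ, r * Real.sin θ) ∈ A ↔ θ ∈ Θ) →
      ((gaussianReal 0 1).prod (gaussianReal 0 1)) A =
        (∫⁻ r in Set.Ioi 0, D r) * volume (Θ ∩ Set.Ioo (-π) π) := by
    intro A hA Θ hΘ h
    rw [gaussianReal_of_var_ne_zero 0 one_ne_zero,
      prod_withDensity (measurable_gaussianPDF _ _) (measurable_gaussianPDF _ _),
      withDensity_apply _ hA, ← lintegral_indicator hA, ← Measure.volume_eq_prod,
      ← lintegral_comp_polarCoord_symm]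
    have h1 : ∫⁻ p in polarCoord.target, ENNReal.ofReal p.1 •
          A.indicator (fun z => gaussianPDF 0 1 z.1 * gaussianPDF 0 1 z.2) (polarCoord.symm p) =
        ∫⁻ p in polarCoord.target, D p.1 * Θ.indicator 1 p.2 := by
      refine setLIntegral_congr_fun polarCoord.open_target.measurableSet ?_
      rintro ⟨r, θ⟩ ⟨hr, hθ⟩
      have hr' : 0 < r := hr
      have hθ' : θ ∈ Set.Ioo (-π) π := hθ
      have hiff := h r hr' θ hθ'
      simp only [polarCoord_symm_apply, smul_eq_mul]
      by_cases hm : θ ∈ Θ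
      · rw [Set.indicator_of_mem (hiff.2 hm), Set.indicator_of_mem hm, Pi.one_apply, mul_one, hD]
        simp only [gaussianPDF, gaussianPDFReal, NNReal.coe_one, mul_one, sub_zero]
        rw [← ENNReal.ofReal_mul (by positivity)]
        congr 2
        rw [mul_mul_mul_comm, ← Real.exp_add]
        congr 2
        linear_combination (-(r ^ 2) / 2) * Real.sin_sq_add_cos_sq θ
      · rw [Set.indicator_of_notMem (fun hA => hm (hiff.1 hA)), Set.indicator_of_notMem hm]
        simp
    rw [h1]
    have : polarCoord.target = Set.Ioi (0 : ℝ) ×ˢ Set.Ioo (-π) π := rfl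
    rw [this, Measure.volume_eq_prod, ← Measure.prod_restrict,
      lintegral_prod_mul hDm.aemeasurable ((measurable_one.indicator hΘ).aemeasurable),
      lintegral_indicator_one hΘ, Measure.restrict_apply hΘ]
  -- The radial integral need not be computed: applying `key` to the whole plane gives its value
  -- from the total mass 1.
  have h2 : (∫⁻ r in Set.Ioi 0, D r) * ENNReal.ofReal (2 * π) = 1 := by
    have := key MeasurableSet.univ (Θ := Set.univ) MeasurableSet.univ (by simp)
    rw [measure_univ, Set.univ_inter, Real.volume_Ioo] at this
    rw [this]
    ring_nf
  rw [key hA hΘ h, ENNReal.eq_inv_of_mul_eq_one_left h2, mul_comm, div_eq_mul_inv]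

/-- The joint law of two linear functionals under the standard Gaussian measure. -/
lemma stdGaussian_map_inner_pair (u v : E) :
    (stdGaussian E).map (fun f => (⟪u, f⟫, ⟪v, f⟫)) =
      ((gaussianReal 0 1).prod (gaussianReal 0 1)).map (fun p : ℝ × ℝ =>
        (‖u‖ * p.2, ‖v‖ * (Real.cos (InnerProductGeometry.angle u v) * p.2 -
          Real.sin (InnerProductGeometry.angle u v) * p.1))) := by
  set α := InnerProductGeometry.angle u v with hα
  let L₁ : E →L[ℝ] ℝ × ℝ := (innerSL ℝ u).prod (innerSL ℝ v)
  let F := ContinuousLinearMap.fst ℝ ℝ ℝ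
  let S := ContinuousLinearMap.snd ℝ ℝ ℝ
  -- At `(r cos θ, r sin θ)` the two components are `‖u‖ r sin θ` and `‖v‖ r sin (θ - α)`, the form
  -- needed for polar coordinates.
  let L₂ : ℝ × ℝ →L[ℝ] ℝ × ℝ :=
    (‖u‖ • S).prod (‖v‖ • (Real.cos α • S - Real.sin α • F))
  change (stdGaussian E).map L₁ = ((gaussianReal 0 1).prod (gaussianReal 0 1)).map L₂
  have := Measure.isProbabilityMeasure_map (μ := stdGaussian E) L₁.continuous.aemeasurable
  have := Measure.isProbabilityMeasure_map (μ := (gaussianReal 0 1).prod (gaussianReal 0 1))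
    L₂.continuous.aemeasurable
  apply Measure.ext_of_charFunDual
  ext L
  rw [charFunDual_map, charFunDual_map, charFunDual_prod]
  set a := L (1, 0) with ha
  set b := L (0, 1) with hb
  have hL : ∀ x y : ℝ, L (x, y) = x * a + y * b := by
    intro x y
    have : ((x, y) : ℝ × ℝ) = x • (1, 0) + y • (0, 1) := by simp
    rw [this, map_add, map_smul, map_smul, smul_eq_mul, smul_eq_mul]
  have h₁ : L.comp L₁ = innerSL ℝ (a • u + b • v) := by
    ext f
    have : L (L₁ f) = ⟪u, f⟫ * a + ⟪v, f⟫ * b := hL _ _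
    simp [this, mul_comm]
  have h₂ : ∀ M : ℝ →L[ℝ] ℝ, charFunDual (gaussianReal 0 1) M =
      Complex.exp (-((M 1 : ℝ) : ℂ) ^ 2 / 2) := by
    intro M
    have hM : ∀ x, M x = M 1 * x := fun x => by
      have := M.map_smul x 1
      simp only [smul_eq_mul, mul_one] at this
      rw [this, mul_comm]
    have := charFun_gaussianReal (μ := 0) (v := 1) (M 1)
    rw [charFun_apply_real] at this
    rw [charFunDual_apply]
    conv_lhs => enter [2, x]; rw [hM x, Complex.ofReal_mul]
    rw [this]
    congr 1
    simp
    ring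
  rw [h₁, h₂, h₂, charFunDual_stdGaussian, innerSL_apply_norm, ← Complex.exp_add]
  congr 1
  have h₃ : (L.comp L₂) (1, 0) = -(‖v‖ * Real.sin α * b) := by
    have : L (L₂ (1, 0)) = _ := hL _ _
    simp [this, F, S]
  have h₄ : (L.comp L₂) (0, 1) = ‖u‖ * a + ‖v‖ * Real.cos α * b := by
    have : L (L₂ (0, 1)) = _ := hL _ _
    simp [this, F, S]
  -- Law of cosines: both centred Gaussian pairs have the same covariance form.
  have h₅ : ‖a • u + b • v‖ ^ 2 =
      (‖v‖ * Real.sin α * b) ^ 2 + (‖u‖ * a + ‖v‖ * Real.cos α * b) ^ 2 := by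
    have hc := InnerProductGeometry.cos_angle_mul_norm_mul_norm u v
    rw [← hα] at hc
    rw [norm_add_sq_real, real_inner_smul_left, real_inner_smul_right, ← hc, norm_smul, norm_smul,
      mul_pow, mul_pow, Real.norm_eq_abs, Real.norm_eq_abs, sq_abs, sq_abs]
    linear_combination -(‖v‖ ^ 2 * b ^ 2) * Real.sin_sq_add_cos_sq α
  have h₆ : (‖a • u + b • v‖ : ℂ) ^ 2 =
      (((L.comp L₂) (1, 0) : ℝ) : ℂ) ^ 2 + (((L.comp L₂) (0, 1) : ℝ) : ℂ) ^ 2 := by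
    rw [h₃, h₄]
    rw [← neg_sq (‖v‖ * Real.sin α * b)] at h₅
    exact_mod_cast h₅
  rw [h₆]
  simp only [ContinuousLinearMap.comp_apply, ContinuousLinearMap.inl_apply,
    ContinuousLinearMap.inr_apply]
  ring

/-- The signs disagree on two antipodal arcs of length `α` each; their share `2α / 2π` of the circle
is the probability `α / π`. -/
lemma sin_mul_sin_sub_neg_iff {α θ : ℝ} (hα : α ∈ Set.Icc 0 π) (hθ : θ ∈ Set.Ioo (-π) π) :
    Real.sin θ * Real.sin (θ - α) < 0 ↔ θ ∈ Set.Ioo 0 α ∪ Set.Ioo (-π) (α - π) := by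
  have hπ := Real.pi_pos
  obtain ⟨hα0, hα1⟩ := hα
  obtain ⟨hθ0, hθ1⟩ := hθ
  have hs : Real.sin (θ - α) = -Real.sin (θ - α + π) := by rw [Real.sin_add_pi, neg_neg]
  rcases lt_trichotomy θ 0 with h | h | h
  · have h1 : Real.sin θ < 0 := Real.sin_neg_of_neg_of_neg_pi_lt h hθ0
    simp only [Set.mem_union, Set.mem_Ioo]
    constructor
    · intro hlt
      right
      refine ⟨hθ0, ?_⟩
      by_contra! hge
      have : Real.sin (θ - α) ≤ 0 := by
        rw [hs, neg_nonpos]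
        exact Real.sin_nonneg_of_nonneg_of_le_pi (by linarith) (by linarith)
      nlinarith
    · rintro (h2 | h2)
      · linarith [h2.1]
      · have : 0 < Real.sin (θ - α) := by
          rw [hs, neg_pos]
          exact Real.sin_neg_of_neg_of_neg_pi_lt (by linarith) (by linarith)
        nlinarith
  · subst h
    simp [hα1]
  · have h1 : 0 < Real.sin θ := Real.sin_pos_of_pos_of_lt_pi h hθ1
    simp only [Set.mem_union, Set.mem_Ioo]
    constructor
    · intro hlt
      left
      refine ⟨h, ?_⟩
      by_contra! hge
      have : 0 ≤ Real.sin (θ - α) :=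
        Real.sin_nonneg_of_nonneg_of_le_pi (by linarith) (by linarith)
      nlinarith
    · rintro (h2 | h2)
      · have : Real.sin (θ - α) < 0 :=
          Real.sin_neg_of_neg_of_neg_pi_lt (by linarith) (by linarith)
        nlinarith
      · linarith [h2.2]

/-- Two linear functionals have opposite signs with probability `angle / π`. -/
lemma stdGaussian_inner_mul_inner_neg {u v : E} (hu : u ≠ 0) (hv : v ≠ 0) :
    (stdGaussian E).real {f | ⟪u, f⟫ * ⟪v, f⟫ < 0} = InnerProductGeometry.angle u v / π := by
  have hπ := Real.pi_pos
  have hu' : 0 < ‖u‖ := norm_pos_iff.2 hu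
  have hv' : 0 < ‖v‖ := norm_pos_iff.2 hv
  set α := InnerProductGeometry.angle u v with hα
  have hα0 : 0 ≤ α := InnerProductGeometry.angle_nonneg _ _
  have hα1 : α ≤ π := InnerProductGeometry.angle_le_pi _ _
  have hS : MeasurableSet {p : ℝ × ℝ | p.1 * p.2 < 0} :=
    measurableSet_lt (by fun_prop) measurable_const
  have h1 : (stdGaussian E) {f | ⟪u, f⟫ * ⟪v, f⟫ < 0} =
      (stdGaussian E).map (fun f => (⟪u, f⟫, ⟪v, f⟫)) {p : ℝ × ℝ | p.1 * p.2 < 0} := by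
    rw [Measure.map_apply (by fun_prop) hS]
    rfl
  have hΘ : (Set.Ioo 0 α ∪ Set.Ioo (-π) (α - π)) ∩ Set.Ioo (-π) π =
      Set.Ioo 0 α ∪ Set.Ioo (-π) (α - π) := by
    rw [Set.inter_eq_left]
    rintro θ (h | h) <;> constructor <;> linarith [h.1, h.2]
  have hdisj : Disjoint (Set.Ioo 0 α) (Set.Ioo (-π) (α - π)) :=
    Set.disjoint_left.2 fun θ h h' => by linarith [h.1, h'.2]
  rw [measureReal_def, h1, stdGaussian_map_inner_pair, Measure.map_apply (by fun_prop) hS,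
    gaussianReal_prod_cone (Θ := Set.Ioo 0 α ∪ Set.Ioo (-π) (α - π)) (hS.preimage (by fun_prop))
      (measurableSet_Ioo.union measurableSet_Ioo), hΘ,
    measure_union hdisj measurableSet_Ioo, Real.volume_Ioo, Real.volume_Ioo,
    ← ENNReal.ofReal_add (by linarith) (by linarith), ← ENNReal.ofReal_div_of_pos (by positivity),
    ENNReal.toReal_ofReal (div_nonneg (by linarith) (by positivity))]
  · field_simp
    ring
  · intro r hr θ hθ
    rw [← sin_mul_sin_sub_neg_iff ⟨hα0, hα1⟩ hθ, Real.sin_sub]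
    have : ‖u‖ * (r * Real.sin θ) *
        (‖v‖ * (Real.cos α * (r * Real.sin θ) - Real.sin α * (r * Real.cos θ))) =
        (‖u‖ * ‖v‖ * r ^ 2) *
          (Real.sin θ * (Real.sin θ * Real.cos α - Real.cos θ * Real.sin α)) := by ring
    simp only [Set.mem_preimage, Set.mem_ofPred_eq]
    rw [this]
    exact ⟨fun h => (pos_iff_neg_of_mul_neg h).1 (by positivity),
      fun h => mul_neg_of_pos_of_neg (by positivity) h⟩

end Gaussian

/-! ### Coefficients, the scalar product and the reproducing kernel -/

variable {Λ : Finset ℤ}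

lemma eq_sum_coeff {P : ℂ[T;T⁻¹]} (hP : ∀ m ∉ Λ, P.coeff m = 0) :
    P = ∑ m ∈ Λ, LaurentPolynomial.C (P.coeff m) * LaurentPolynomial.T m := by
  ext n
  simp only [← LaurentPolynomial.smul_eq_C_mul, AddMonoidAlgebra.coeff_sum, Finsupp.finsetSum_apply,
    AddMonoidAlgebra.coeff_smul, Finsupp.smul_apply, LaurentPolynomial.T_apply, smul_eq_mul,
    mul_ite, mul_one, mul_zero, Finset.sum_ite_eq']
  split_ifs with h
  · rfl
  · exact hP n h

lemma value_eq_sum {P : ℂ[T;T⁻¹]} (hP : ∀ m ∉ Λ, P.coeff m = 0) (z : ℂˣ) :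
    value P z = ∑ m ∈ Λ, P.coeff m * (z : ℂ) ^ m := by
  conv_lhs => rw [eq_sum_coeff hP, value, map_sum]
  simp [LaurentPolynomial.eval₂_C_mul_T]

/-- The real Laurent polynomial with spectrum `Λ` and given Hermitian symmetric coefficients. -/
def ofCoeff (hsymm : ∀ l ∈ Λ, -l ∈ Λ) (c : ℤ → ℂ) (hc : ∀ m, c (-m) = conj (c m)) :
    realLaurent Λ := by
  have hcoeff : ∀ n, (∑ m ∈ Λ, LaurentPolynomial.C (c m) * LaurentPolynomial.T m).coeff n =
      if n ∈ Λ then c n else 0 := by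
    intro n
    simp only [← LaurentPolynomial.smul_eq_C_mul, AddMonoidAlgebra.coeff_sum,
      Finsupp.finsetSum_apply, AddMonoidAlgebra.coeff_smul, Finsupp.smul_apply,
      LaurentPolynomial.T_apply, smul_eq_mul, mul_ite, mul_one, mul_zero, Finset.sum_ite_eq']
  have hs : ∀ m ∉ Λ,
      (∑ m ∈ Λ, LaurentPolynomial.C (c m) * LaurentPolynomial.T m).coeff m = 0 :=
    fun m hm => by rw [hcoeff, if_neg hm]
  refine ⟨∑ m ∈ Λ, LaurentPolynomial.C (c m) * LaurentPolynomial.T m, hs, fun z hz => ?_⟩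
  rw [← Complex.conj_eq_iff_im, value_eq_sum hs, map_sum]
  -- On the unit circle conjugation inverts `z`, so it exchanges the terms of index `m` and `-m`.
  refine Finset.sum_nbij' (fun m => -m) (fun m => -m) hsymm hsymm (by simp) (by simp) ?_
  intro m hm
  have hz' : conj (z : ℂ) = (z : ℂ)⁻¹ := by
    rw [Complex.inv_def, Complex.normSq_eq_norm_sq, hz]
    simp
  rw [hcoeff, hcoeff, if_pos hm, if_pos (hsymm m hm), map_mul, map_zpow₀, hz', hc, inv_zpow,
    zpow_neg]

lemma coeff_ofCoeff (hsymm : ∀ l ∈ Λ, -l ∈ Λ) (c : ℤ → ℂ) (hc : ∀ m, c (-m) = conj (c m)) (n : ℤ) :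
    (ofCoeff hsymm c hc : ℂ[T;T⁻¹]).coeff n = if n ∈ Λ then c n else 0 := by
  change (∑ m ∈ Λ, LaurentPolynomial.C (c m) * LaurentPolynomial.T m).coeff n = _
  simp only [← LaurentPolynomial.smul_eq_C_mul, AddMonoidAlgebra.coeff_sum,
    Finsupp.finsetSum_apply, AddMonoidAlgebra.coeff_smul, Finsupp.smul_apply,
    LaurentPolynomial.T_apply, smul_eq_mul, mul_ite, mul_one, mul_zero, Finset.sum_ite_eq']

lemma ofReal_trig (P : realLaurent Λ) (θ : ℝ) :
    (trig P θ : ℂ) = value P (Circle.toUnits (Circle.exp θ)) :=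
  Complex.ext (by simp [trig]) (by simpa using (P.2.2 _ (by simp)).symm)

lemma ofReal_trig_eq_sum (P : realLaurent Λ) (θ : ℝ) :
    (trig P θ : ℂ) =
      ∑ m ∈ Λ, (P : ℂ[T;T⁻¹]).coeff m * Complex.exp (m * Complex.I * θ) := by
  rw [ofReal_trig, value_eq_sum P.2.1]
  refine Finset.sum_congr rfl fun m _ => ?_
  rw [Circle.toUnits_apply, Units.val_mk0, Circle.coe_exp, ← Complex.exp_int_mul]
  ring_nf

lemma integral_exp_int_mul (k : ℤ) :
    ∫ θ in (0 : ℝ)..(2 * π), Complex.exp (k * Complex.I * θ) = if k = 0 then 2 * (π : ℂ) else 0 := by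
  split_ifs with h
  · simp [h]
  · have hk : (k : ℂ) * Complex.I ≠ 0 := mul_ne_zero (Int.cast_ne_zero.2 h) Complex.I_ne_zero
    rw [integral_exp_mul_complex hk]
    have : (k : ℂ) * Complex.I * ((2 * π : ℝ) : ℂ) = k * (2 * π * Complex.I) := by
      push_cast
      ring
    rw [this, Complex.exp_int_mul_two_pi_mul_I]
    simp

/-- Orthogonality of characters. The pairing integrates `A B` without conjugation, so only the pairs
of indices `l = -m` survive. -/
lemma ofReal_inner_eq_sum (A B : realLaurent Λ) :
    ((⟪A, B⟫ : ℝ) : ℂ) =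
      ∑ m ∈ Λ, (A : ℂ[T;T⁻¹]).coeff (-m) * (B : ℂ[T;T⁻¹]).coeff m := by
  have hπ : (π : ℂ) ≠ 0 := Complex.ofReal_ne_zero.2 Real.pi_ne_zero
  have h : (⟪A, B⟫ : ℝ) = (1 / (2 * π)) * ∫ θ in (0 : ℝ)..(2 * π), trig A θ * trig B θ := rfl
  rw [h, Complex.ofReal_mul, ← intervalIntegral.integral_ofReal]
  have h1 : ∀ θ : ℝ, ((trig A θ * trig B θ : ℝ) : ℂ) = ∑ m ∈ Λ, ∑ l ∈ Λ,
      ((A : ℂ[T;T⁻¹]).coeff l * (B : ℂ[T;T⁻¹]).coeff m) *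
        Complex.exp ((l + m : ℤ) * Complex.I * θ) := by
    intro θ
    rw [Complex.ofReal_mul, ofReal_trig_eq_sum, ofReal_trig_eq_sum, Finset.sum_mul_sum,
      Finset.sum_comm]
    refine Finset.sum_congr rfl fun m _ => Finset.sum_congr rfl fun l _ => ?_
    rw [mul_mul_mul_comm, ← Complex.exp_add]
    push_cast
    ring_nf
  simp_rw [h1]
  rw [intervalIntegral.integral_finsetSum fun m _ =>
    Continuous.intervalIntegrable (by fun_prop) _ _, Finset.mul_sum]
  refine Finset.sum_congr rfl fun m hm => ?_
  rw [intervalIntegral.integral_finsetSum fun l _ =>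
    Continuous.intervalIntegrable (by fun_prop) _ _]
  simp_rw [intervalIntegral.integral_const_mul, integral_exp_int_mul, mul_ite, mul_zero]
  have h2 : ∀ l : ℤ, l + m = 0 ↔ l = -m := fun l => eq_neg_iff_add_eq_zero.symm
  simp_rw [h2, Finset.sum_ite_eq']
  split_ifs with hm'
  · push_cast
    field_simp
  · rw [A.2.1 _ hm', zero_mul, mul_zero]

/-- The reproducing kernel: the vector of `realLaurent Λ` representing evaluation at `e^{it}`. -/
def evalVec (hsymm : ∀ l ∈ Λ, -l ∈ Λ) (t : ℝ) : realLaurent Λ :=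
  ofCoeff hsymm (fun m => Complex.exp (-(m * Complex.I * t))) fun m => by
    rw [← Complex.exp_conj]
    simp

lemma inner_evalVec (hsymm : ∀ l ∈ Λ, -l ∈ Λ) (t : ℝ) (P : realLaurent Λ) :
    ⟪evalVec hsymm t, P⟫ = trig P t := by
  apply Complex.ofReal_injective
  rw [ofReal_inner_eq_sum, ofReal_trig_eq_sum]
  refine Finset.sum_congr rfl fun m hm => ?_
  rw [evalVec, coeff_ofCoeff, if_pos (hsymm m hm), mul_comm]
  simp

lemma inner_evalVec_evalVec (hsymm : ∀ l ∈ Λ, -l ∈ Λ) (s t : ℝ) :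
    ⟪evalVec hsymm s, evalVec hsymm t⟫ = ∑ m ∈ Λ, Real.cos (m * (s - t)) := by
  rw [inner_evalVec]
  have h := congrArg Complex.re (ofReal_trig_eq_sum (evalVec hsymm t) s)
  rw [Complex.ofReal_re, Complex.re_sum] at h
  rw [h]
  refine Finset.sum_congr rfl fun m hm => ?_
  rw [evalVec, coeff_ofCoeff, if_pos hm, ← Complex.exp_add, ← Complex.exp_ofReal_mul_I_re]
  congr 2
  push_cast
  ring

lemma norm_evalVec (hsymm : ∀ l ∈ Λ, -l ∈ Λ) (t : ℝ) :
    ‖evalVec hsymm t‖ = √(Λ.card : ℝ) := by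
  rw [norm_eq_sqrt_real_inner, inner_evalVec_evalVec]
  simp

lemma evalVec_ne_zero (hne : Λ.Nonempty) (hsymm : ∀ l ∈ Λ, -l ∈ Λ) (t : ℝ) :
    evalVec hsymm t ≠ 0 := by
  rw [← norm_pos_iff, norm_evalVec]
  exact Real.sqrt_pos.2 (by exact_mod_cast hne.card_pos)

/-- The cosine of the angle is the mean of `cos (m (s - t))`, that is `1 - 2q` with `q` the mean of
the squared half-angle sines. The form `2 arcsin √q` suits small `s - t`: `arcsin` is differentiable
at 0, whereas `arccos` is not at 1. -/
lemma angle_evalVec (hne : Λ.Nonempty) (hsymm : ∀ l ∈ Λ, -l ∈ Λ) (s t : ℝ) :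
    InnerProductGeometry.angle (evalVec hsymm s) (evalVec hsymm t) =
      2 * Real.arcsin √((1 / (Λ.card : ℝ)) * ∑ m ∈ Λ, Real.sin (m * (s - t) / 2) ^ 2) := by
  have hc : (0 : ℝ) < Λ.card := by exact_mod_cast hne.card_pos
  set q := (1 / (Λ.card : ℝ)) * ∑ m ∈ Λ, Real.sin (m * (s - t) / 2) ^ 2 with hq
  have hq0 : 0 ≤ q := mul_nonneg (by positivity) (Finset.sum_nonneg fun _ _ => sq_nonneg _)
  have hq1 : q ≤ 1 := by
    rw [hq, one_div, inv_mul_le_iff₀ hc, mul_one]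
    calc ∑ m ∈ Λ, Real.sin (m * (s - t) / 2) ^ 2 ≤ ∑ m ∈ Λ, (1 : ℝ) :=
          Finset.sum_le_sum fun m _ => Real.sin_sq_le_one _
      _ = Λ.card := by simp
  have h0 := Real.arcsin_nonneg.2 (Real.sqrt_nonneg q)
  have h1 := Real.arcsin_le_pi_div_two √q
  rw [InnerProductGeometry.angle, norm_evalVec, norm_evalVec, Real.mul_self_sqrt hc.le,
    inner_evalVec_evalVec, ← Real.arccos_cos (x := 2 * Real.arcsin √q) (by linarith) (by linarith),
    Real.cos_two_mul', Real.cos_sq', Real.sin_arcsin (by linarith [Real.sqrt_nonneg q])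
      (Real.sqrt_le_one.2 hq1), Real.sq_sqrt hq0]
  congr 1
  have : ∀ m ∈ Λ, Real.cos (m * (s - t)) = 1 - 2 * Real.sin (m * (s - t) / 2) ^ 2 := by
    intro m _
    have := Real.cos_two_mul (m * (s - t) / 2)
    rw [mul_div_cancel₀ _ two_ne_zero] at this
    rw [this, Real.cos_sq']
    ring
  rw [Finset.sum_congr rfl this, Finset.sum_sub_distrib, ← Finset.mul_sum, hq]
  simp only [Finset.sum_const, nsmul_eq_mul, mul_one]
  generalize ∑ m ∈ Λ, Real.sin (m * (s - t) / 2) ^ 2 = S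
  field_simp
  ring

/-- The probability of a sign change between two points of the circle. -/
lemma law_trig_mul_trig_neg (hne : Λ.Nonempty) (hsymm : ∀ l ∈ Λ, -l ∈ Λ) (s t : ℝ) :
    (law Λ).real {P | trig P s * trig P t < 0} =
      2 * Real.arcsin √((1 / (Λ.card : ℝ)) * ∑ m ∈ Λ, Real.sin (m * (s - t) / 2) ^ 2) / π := by
  rw [← angle_evalVec hne hsymm s t, ← stdGaussian_inner_mul_inner_neg (evalVec_ne_zero hne hsymm s)
    (evalVec_ne_zero hne hsymm t)]
  simp_rw [inner_evalVec]
  rfl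

/-! ### Almost sure simplicity and number of the roots -/

/-- In a pencil `g + t h` with `h` separable of maximal degree, only countably many members have a
multiple root. -/
lemma countable_multiple_root {g h : Polynomial ℂ} (hh : h.Separable)
    (hdeg : g.natDegree ≤ h.natDegree) :
    {t : ℝ | ∃ z, (g + Polynomial.C (t : ℂ) * h).IsRoot z ∧
      (g + Polynomial.C (t : ℂ) * h).derivative.IsRoot z}.Countable := by
  have hcop : ∀ z, h.eval z = 0 → h.derivative.eval z = 0 → False := by
    intro z h0 h1
    obtain ⟨a, b, hab⟩ := hh
    have := congrArg (Polynomial.eval z) hab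
    simp [h0, h1] at this
  -- A multiple root of `g + t h` is a zero of the Wronskian of `g` and `h`, which does not depend
  -- on `t`. If the Wronskian vanishes identically, a member with a multiple root is a constant
  -- multiple of the separable `h`, hence zero, and this happens for at most one `t`.
  by_cases hW : Polynomial.wronskian g h = 0
  · have hzero : ∀ t : ℝ, (∃ z, (g + Polynomial.C (t : ℂ) * h).IsRoot z ∧
        (g + Polynomial.C (t : ℂ) * h).derivative.IsRoot z) →
        g + Polynomial.C (t : ℂ) * h = 0 := by
      rintro t ⟨z, hz, hz'⟩
      set q := g + Polynomial.C (t : ℂ) * h with hq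
      have hqW : q * h.derivative = q.derivative * h := by
        have hW' : g * h.derivative - g.derivative * h = 0 := hW
        rw [hq, Polynomial.derivative_add, Polynomial.derivative_C_mul]
        linear_combination hW'
      have hdvd : h ∣ q :=
        IsCoprime.dvd_of_dvd_mul_right hh ⟨q.derivative, by rw [hqW, mul_comm]⟩
      have hqdeg : q.natDegree ≤ h.natDegree :=
        Polynomial.natDegree_add_le_of_degree_le hdeg (Polynomial.natDegree_C_mul_le _ _)
      obtain ⟨c, hc⟩ := hdvd
      by_contra hq0
      have hc0 : c ≠ 0 := fun h => hq0 (by rw [hc, h, mul_zero])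
      have hh0 : h ≠ 0 := hh.ne_zero
      rw [hc, Polynomial.natDegree_mul hh0 hc0] at hqdeg
      obtain ⟨a, rfl⟩ := Polynomial.natDegree_eq_zero.1 (show c.natDegree = 0 by omega)
      have ha : a ≠ 0 := by simpa using hc0
      rw [hc] at hz hz'
      refine hcop z ?_ ?_
      · simpa [ha] using hz
      · simpa [ha] using hz'
    refine Set.Subsingleton.countable fun t ht t' ht' => ?_
    have h1 := (hzero t ht).trans (hzero t' ht').symm
    have h2 : Polynomial.C ((t : ℂ) - t') * h = 0 := by
      rw [Polynomial.C_sub]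
      linear_combination h1
    rw [mul_eq_zero, Polynomial.C_eq_zero, or_iff_left hh.ne_zero, sub_eq_zero] at h2
    exact_mod_cast h2
  · refine Set.Countable.mono (s₂ := ⋃ z ∈ (Polynomial.wronskian g h).roots.toFinset,
      {t : ℝ | (g + Polynomial.C (t : ℂ) * h).IsRoot z ∧
        (g + Polynomial.C (t : ℂ) * h).derivative.IsRoot z}) ?_ ?_
    · rintro t ⟨z, hz, hz'⟩
      simp only [Set.mem_iUnion]
      refine ⟨z, ?_, hz, hz'⟩
      rw [Multiset.mem_toFinset, Polynomial.mem_roots hW]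
      simp only [Polynomial.IsRoot, Polynomial.eval_add, Polynomial.eval_mul, Polynomial.eval_C,
        Polynomial.derivative_add, Polynomial.derivative_C_mul] at hz hz'
      simp only [Polynomial.IsRoot, Polynomial.wronskian, Polynomial.eval_sub, Polynomial.eval_mul]
      linear_combination h.derivative.eval z * hz - h.eval z * hz'
    -- Two parameters sharing the multiple root `z` would make `z` a multiple root of `h`.
    · refine Set.Countable.biUnion (Finset.countable_toSet _) fun z _ => ?_
      refine Set.Subsingleton.countable fun t ht t' ht' => ?_
      by_contra hne
      have hne' : (t : ℂ) - t' ≠ 0 := sub_ne_zero.2 (by exact_mod_cast hne)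
      obtain ⟨h1, h2⟩ := ht
      obtain ⟨h3, h4⟩ := ht'
      simp only [Polynomial.IsRoot, Polynomial.eval_add, Polynomial.eval_mul, Polynomial.eval_C,
        Polynomial.derivative_add, Polynomial.derivative_C_mul] at h1 h2 h3 h4
      refine hcop z ((mul_eq_zero.1 ?_).resolve_left hne') ((mul_eq_zero.1 ?_).resolve_left hne')
      · linear_combination h1 - h3
      · linear_combination h2 - h4

lemma natAbs_le_degree {m : ℤ} (hm : m ∈ Λ) : m.natAbs ≤ degree Λ :=
  Finset.le_sup (f := Int.natAbs) hm

lemma degree_mem (hne : Λ.Nonempty) (hsymm : ∀ l ∈ Λ, -l ∈ Λ) : (degree Λ : ℤ) ∈ Λ := by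
  obtain ⟨m, hm, h⟩ := Finset.exists_mem_eq_sup Λ hne Int.natAbs
  have h' : degree Λ = m.natAbs := h
  rcases Int.natAbs_eq m with hm' | hm'
  · rwa [h', ← hm']
  · have := hsymm m hm
    rw [hm', neg_neg] at this
    rwa [h']

/-- The polynomial `z^d P(z)`, where `d` is the degree of the spectrum. -/
def poly (P : realLaurent Λ) : Polynomial ℂ :=
  ∑ m ∈ Λ, Polynomial.C ((P : ℂ[T;T⁻¹]).coeff m) * Polynomial.X ^ (m + degree Λ).toNat

lemma coeff_poly (P : realLaurent Λ) (n : ℕ) :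
    (poly P).coeff n = (P : ℂ[T;T⁻¹]).coeff (n - degree Λ) := by
  simp only [poly, Polynomial.finsetSum_coeff, Polynomial.coeff_C_mul_X_pow]
  have : ∀ m ∈ Λ, (if n = (m + degree Λ).toNat then (P : ℂ[T;T⁻¹]).coeff m else 0) =
      if m = (n : ℤ) - degree Λ then (P : ℂ[T;T⁻¹]).coeff m else 0 := by
    intro m hm
    have := natAbs_le_degree hm
    refine if_congr ?_ rfl rfl
    omega
  rw [Finset.sum_congr rfl this, Finset.sum_ite_eq']
  split_ifs with h
  · rfl
  · rw [P.2.1 _ h]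

lemma poly_add_smul (P Q : realLaurent Λ) (t : ℝ) :
    poly (P + t • Q) = poly P + Polynomial.C (t : ℂ) * poly Q := by
  ext n
  simp [coeff_poly]

lemma natDegree_poly_le (P : realLaurent Λ) : (poly P).natDegree ≤ 2 * degree Λ := by
  refine Polynomial.natDegree_le_iff_coeff_eq_zero.2 fun n hn => ?_
  rw [coeff_poly]
  refine P.2.1 _ fun h => ?_
  have := natAbs_le_degree h
  omega

lemma eval_poly (P : realLaurent Λ) (z : ℂˣ) :
    (poly P).eval (z : ℂ) = (z : ℂ) ^ degree Λ * value P z := by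
  rw [value_eq_sum P.2.1, poly, Polynomial.eval_finsetSum, Finset.mul_sum]
  refine Finset.sum_congr rfl fun m hm => ?_
  have := natAbs_le_degree hm
  rw [Polynomial.eval_mul, Polynomial.eval_C, Polynomial.eval_pow, Polynomial.eval_X,
    ← zpow_natCast, ← zpow_natCast, Int.toNat_of_nonneg (by omega), zpow_add₀ z.ne_zero]
  ring

/-- The real Laurent polynomial `z^d + z^{-d}` (or `1` if `d = 0`). -/
def extremal (hsymm : ∀ l ∈ Λ, -l ∈ Λ) : realLaurent Λ :=
  ofCoeff hsymm (fun m => if m.natAbs = degree Λ then 1 else 0) fun m => by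
    rw [Int.natAbs_neg, apply_ite (starRingEnd ℂ), map_one, map_zero]

lemma coeff_extremal (hne : Λ.Nonempty) (hsymm : ∀ l ∈ Λ, -l ∈ Λ) (m : ℤ) :
    (extremal hsymm : ℂ[T;T⁻¹]).coeff m = if m.natAbs = degree Λ then 1 else 0 := by
  rw [extremal, coeff_ofCoeff]
  split_ifs with h1 h2 h2
  · rfl
  · rfl
  · refine absurd ?_ h1
    have hd := degree_mem hne hsymm
    rw [← h2] at hd
    rcases Int.natAbs_eq m with hm | hm
    · rwa [hm]
    · rw [hm]
      exact hsymm _ hd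
  · rfl

lemma extremal_ne_zero (hne : Λ.Nonempty) (hsymm : ∀ l ∈ Λ, -l ∈ Λ) : extremal hsymm ≠ 0 := by
  intro h
  have := coeff_extremal hne hsymm (degree Λ)
  rw [h] at this
  simp at this

/-- The polynomial is `X^{2d} + 1`, or `1` when `d = 0`. Being separable and of the largest possible
degree, it can serve as the direction in `countable_multiple_root`. -/
lemma separable_poly_extremal (hne : Λ.Nonempty) (hsymm : ∀ l ∈ Λ, -l ∈ Λ) :
    (poly (extremal hsymm)).Separable := by
  rcases Nat.eq_zero_or_pos (degree Λ) with hd | hd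
  · have : poly (extremal hsymm) = 1 := by
      ext n
      rw [coeff_poly, coeff_extremal hne, hd, Polynomial.coeff_one]
      refine if_congr ?_ rfl rfl
      omega
    rw [this]
    exact Polynomial.separable_one
  · have : poly (extremal hsymm) = Polynomial.X ^ (2 * degree Λ) - Polynomial.C (-1) := by
      ext n
      rw [coeff_poly, coeff_extremal hne, Polynomial.coeff_sub, Polynomial.coeff_X_pow,
        Polynomial.coeff_C]
      have : ((n : ℤ) - degree Λ).natAbs = degree Λ ↔ n = 2 * degree Λ ∨ n = 0 := by omega
      simp only [this]
      by_cases h1 : n = 2 * degree Λ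
      · simp [h1, hd.ne']
      · by_cases h2 : n = 0 <;> simp [h1, h2, hd.ne']
    rw [this]
    exact Polynomial.separable_X_pow_sub_C _
      (by exact_mod_cast (show 2 * degree Λ ≠ 0 by omega)) (by simp)

lemma natDegree_poly_extremal (hne : Λ.Nonempty) (hsymm : ∀ l ∈ Λ, -l ∈ Λ) :
    (poly (extremal hsymm)).natDegree = 2 * degree Λ := by
  refine le_antisymm (natDegree_poly_le _) (Polynomial.le_natDegree_of_ne_zero ?_)
  rw [coeff_poly, coeff_extremal hne, if_pos (by omega)]
  exact one_ne_zero

lemma continuous_coeff (m : ℤ) :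
    Continuous fun P : realLaurent Λ => (P : ℂ[T;T⁻¹]).coeff m := by
  let L : realLaurent Λ →ₗ[ℝ] ℂ :=
    { toFun := fun P => (P : ℂ[T;T⁻¹]).coeff m
      map_add' := fun P Q => by simp
      map_smul' := fun c P => by simp }
  exact L.continuous_of_finiteDimensional

/-- The set of real Laurent polynomials for which `poly` has a multiple root. -/
def multipleRoot (Λ : Finset ℤ) : Set (realLaurent Λ) :=
  {P | ∃ z, (poly P).IsRoot z ∧ (poly P).derivative.IsRoot z}

/-- The set is the projection of a closed subset of `realLaurent Λ × ℂ`. That subset is σ-compact,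
hence so is its image, which is therefore Borel. -/
lemma measurableSet_multipleRoot : MeasurableSet (multipleRoot Λ) := by
  have : ProperSpace (realLaurent Λ) := FiniteDimensional.proper_real _
  have hc1 : Continuous fun p : realLaurent Λ × ℂ => (poly p.1).eval p.2 := by
    simp only [poly, Polynomial.eval_finsetSum, Polynomial.eval_mul, Polynomial.eval_C,
      Polynomial.eval_pow, Polynomial.eval_X]
    exact continuous_finsetSum _ fun m _ =>
      ((continuous_coeff m).comp continuous_fst).mul (continuous_snd.pow _)
  have hc2 : Continuous fun p : realLaurent Λ × ℂ => (poly p.1).derivative.eval p.2 := by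
    simp only [poly, Polynomial.derivative_sum, Polynomial.derivative_C_mul_X_pow,
      Polynomial.eval_finsetSum, Polynomial.eval_mul, Polynomial.eval_C,
      Polynomial.eval_pow, Polynomial.eval_X]
    exact continuous_finsetSum _ fun m _ =>
      (((continuous_coeff m).comp continuous_fst).mul continuous_const).mul (continuous_snd.pow _)
  have hclosed : IsClosed {p : realLaurent Λ × ℂ | (poly p.1).eval p.2 = 0 ∧
      (poly p.1).derivative.eval p.2 = 0} :=
    (isClosed_singleton.preimage hc1).inter (isClosed_singleton.preimage hc2)
  have himage : multipleRoot Λ = Prod.fst '' {p : realLaurent Λ × ℂ | (poly p.1).eval p.2 = 0 ∧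
      (poly p.1).derivative.eval p.2 = 0} := by
    ext P
    constructor
    · rintro ⟨z, hz⟩
      exact ⟨(P, z), hz, rfl⟩
    · rintro ⟨⟨_, z⟩, hz, rfl⟩
      exact ⟨z, hz⟩
  obtain ⟨K, hK, hKU⟩ :=
    (isSigmaCompact_univ.of_isClosed_subset hclosed (Set.subset_univ _)).image continuous_fst
  rw [himage, ← hKU]
  exact MeasurableSet.iUnion fun n => (hK n).measurableSet

lemma law_multipleRoot (hne : Λ.Nonempty) (hsymm : ∀ l ∈ Λ, -l ∈ Λ) :
    law Λ (multipleRoot Λ) = 0 := by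
  refine stdGaussian_eq_zero_of_lines measurableSet_multipleRoot (extremal_ne_zero hne hsymm)
    fun g => ?_
  simp only [multipleRoot, Set.mem_ofPred_eq, poly_add_smul]
  exact countable_multiple_root (separable_poly_extremal hne hsymm)
    ((natDegree_poly_le g).trans_eq (natDegree_poly_extremal hne hsymm).symm)

lemma law_coeff_eq_zero (hne : Λ.Nonempty) (hsymm : ∀ l ∈ Λ, -l ∈ Λ) {m : ℤ}
    (hm : m.natAbs = degree Λ) : law Λ {P | (P : ℂ[T;T⁻¹]).coeff m = 0} = 0 := by
  refine stdGaussian_eq_zero_of_lines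
    (isClosed_singleton.preimage (continuous_coeff m)).measurableSet (extremal_ne_zero hne hsymm)
    fun g => Set.Subsingleton.countable fun t ht t' ht' => ?_
  have h1 : (g : ℂ[T;T⁻¹]).coeff m + t * 1 = 0 := by
    simpa [coeff_extremal hne hsymm, hm] using ht
  have h2 : (g : ℂ[T;T⁻¹]).coeff m + t' * 1 = 0 := by
    simpa [coeff_extremal hne hsymm, hm] using ht'
  have h3 : (t : ℂ) = t' := by linear_combination h1 - h2
  exact_mod_cast h3

/-- Moving along `evalVec θ` changes the value at `θ` at the nonzero rate `‖evalVec θ‖²`, so each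
line meets the hyperplane at most once. -/
lemma law_trig_eq_zero (hne : Λ.Nonempty) (hsymm : ∀ l ∈ Λ, -l ∈ Λ) (θ : ℝ) :
    law Λ {P | trig P θ = 0} = 0 := by
  have hm : MeasurableSet {P : realLaurent Λ | trig P θ = 0} := by
    simp_rw [← inner_evalVec hsymm]
    exact measurableSet_eq_fun (by fun_prop) measurable_const
  refine stdGaussian_eq_zero_of_lines hm (evalVec_ne_zero hne hsymm θ)
    fun g => Set.Subsingleton.countable fun t ht t' ht' => ?_
  have h0 : trig (evalVec hsymm θ) θ ≠ 0 := by
    rw [← inner_evalVec hsymm]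
    exact inner_self_ne_zero.2 (evalVec_ne_zero hne hsymm θ)
  have h1 : trig g θ + t * trig (evalVec hsymm θ) θ = 0 := by
    rw [← trig_smul, ← trig_add]
    exact ht
  have h2 : trig g θ + t' * trig (evalVec hsymm θ) θ = 0 := by
    rw [← trig_smul, ← trig_add]
    exact ht'
  exact mul_right_cancel₀ h0 (by linarith)

/-- The top coefficient fixes the degree of `poly P`, the bottom one excludes the root 0, and
simplicity makes the number of distinct roots equal the degree. -/
lemma ncard_roots {P : realLaurent Λ} (hmult : P ∉ multipleRoot Λ)
    (h1 : (P : ℂ[T;T⁻¹]).coeff (degree Λ) ≠ 0) (h2 : (P : ℂ[T;T⁻¹]).coeff (-degree Λ) ≠ 0) :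
    (roots (P : ℂ[T;T⁻¹])).Finite ∧ (roots (P : ℂ[T;T⁻¹])).ncard = 2 * degree Λ := by
  have hlead : (poly P).coeff (2 * degree Λ) ≠ 0 := by
    rw [coeff_poly]
    convert h1 using 2
    push_cast
    ring
  have hdeg : (poly P).natDegree = 2 * degree Λ :=
    le_antisymm (natDegree_poly_le _) (Polynomial.le_natDegree_of_ne_zero hlead)
  have h0 : poly P ≠ 0 := fun h => hlead (by rw [h, Polynomial.coeff_zero])
  have hnodup : (poly P).roots.Nodup := by
    rw [Multiset.nodup_iff_count_le_one]
    intro z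
    rw [Polynomial.count_roots]
    by_contra! h
    exact hmult ⟨z, (Polynomial.one_lt_rootMultiplicity_iff_isRoot h0).1 h⟩
  have himage : Units.val '' roots (P : ℂ[T;T⁻¹]) = ((poly P).roots.toFinset : Set ℂ) := by
    ext z
    simp only [Finset.mem_coe, Multiset.mem_toFinset, Polynomial.mem_roots h0]
    constructor
    · rintro ⟨z, hz, rfl⟩
      have hz' : value P z = 0 := hz
      rw [Polynomial.IsRoot, eval_poly, hz', mul_zero]
    · intro hz
      have hz0 : z ≠ 0 := by
        rintro rfl
        rw [Polynomial.IsRoot, ← Polynomial.coeff_zero_eq_eval_zero, coeff_poly] at hz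
        exact h2 (by simpa using hz)
      refine ⟨Units.mk0 z hz0, ?_, rfl⟩
      have := eval_poly P (Units.mk0 z hz0)
      rw [Units.val_mk0, hz.eq_zero, eq_comm, mul_eq_zero] at this
      exact this.resolve_left (pow_ne_zero _ hz0)
  constructor
  · refine Set.Finite.of_finite_image ?_ Units.val_injective.injOn
    rw [himage]
    exact Finset.finite_toSet _
  · rw [← Set.ncard_image_of_injective _ Units.val_injective, himage, Set.ncard_coe_finset,
      Multiset.toFinset_card_of_nodup hnodup, ← hdeg]
    exact (IsAlgClosed.splits (poly P)).natDegree_eq_card_roots.symm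

/-! ### Counting zeros by sign changes on a grid -/

/-- A function changes its sign at a simple zero. -/
lemma exists_sign_change_of_hasDerivAt {g : ℝ → ℝ} {g' θ : ℝ} (hg : HasDerivAt g g' θ)
    (hg' : g' ≠ 0) (h0 : g θ = 0) :
    ∃ δ > 0, ∀ x y, θ - δ < x → x < θ → θ < y → y < θ + δ → g x * g y < 0 := by
  have h1 : Tendsto (fun x => slope g θ x * g') (𝓝[≠] θ) (𝓝 (g' * g')) :=
    (hasDerivAt_iff_tendsto_slope.1 hg).mul_const g'
  have h2 := h1.eventually_const_lt (mul_self_pos.2 hg')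
  rw [eventually_nhdsWithin_iff, Metric.eventually_nhds_iff] at h2
  obtain ⟨δ, hδ, h⟩ := h2
  -- Near `θ` the difference quotient has the sign of `g'`, so `g x * g'` has the sign of `x - θ`.
  have key : ∀ x, |x - θ| < δ → x ≠ θ → 0 < (x - θ) * (g x * g') := by
    intro x hx hne
    have h3 := h (show dist x θ < δ from hx) hne
    have hne' : x - θ ≠ 0 := sub_ne_zero.2 hne
    rw [slope_def_field, h0, sub_zero] at h3
    have h4 : (x - θ) * (g x * g') = (x - θ) ^ 2 * (g x / (x - θ) * g') := by
      field_simp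
    rw [h4]
    positivity
  refine ⟨δ, hδ, fun x y hx hxθ hy hyδ => ?_⟩
  have hx' := key x (by rw [abs_lt]; constructor <;> linarith) hxθ.ne
  have hy' := key y (by rw [abs_lt]; constructor <;> linarith) hy.ne'
  have hx1 : g x * g' < 0 := by
    by_contra! hc
    exact absurd hx' (not_lt.2 (mul_nonpos_of_nonpos_of_nonneg (by linarith) hc))
  have hy1 : 0 < g y * g' := pos_of_mul_pos_right hy' (by linarith)
  by_contra! hc
  have h5 : (g x * g') * (g y * g') < 0 := mul_neg_of_neg_of_pos hx1 hy1
  have h6 : (g x * g') * (g y * g') = (g x * g y) * (g' * g') := by ring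
  rw [h6] at h5
  exact absurd h5 (not_lt.2 (mul_nonneg hc (mul_self_nonneg _)))

/-- The number of sign changes of `g` along the grid dividing `[0, 2π]` into `n` equal parts. -/
def signChanges (g : ℝ → ℝ) (n : ℕ) : ℕ :=
  ((Finset.range n).filter fun j : ℕ =>
    g (2 * π * j / n) * g (2 * π * (j + 1) / n) < 0).card

/-- The zeros of a function in one period. -/
def zeros (g : ℝ → ℝ) : Set ℝ := {θ | θ ∈ Set.Ico 0 (2 * π) ∧ g θ = 0}

lemma exists_zero_of_mul_neg {g : ℝ → ℝ} (hg : Continuous g) {a b : ℝ} (hab : a ≤ b)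
    (h : g a * g b < 0) : ∃ x ∈ Set.Ioo a b, g x = 0 := by
  rcases mul_neg_iff.1 h with ⟨h1, h2⟩ | ⟨h1, h2⟩
  · exact intermediate_value_Ioo' hab hg.continuousOn ⟨h2, h1⟩
  · exact intermediate_value_Ioo hab hg.continuousOn ⟨h1, h2⟩

/-- Each sign change yields a zero inside its open cell, and the cells are disjoint. Finiteness
matters because `ncard` of an infinite set is 0. -/
lemma signChanges_le {g : ℝ → ℝ} (hg : Continuous g) (hfin : (zeros g).Finite) (n : ℕ) :
    signChanges g n ≤ (zeros g).ncard := by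
  have hπ := Real.pi_pos
  have hz : ∀ j : ℕ, j ∈ (Finset.range n).filter (fun j : ℕ =>
      g (2 * π * j / n) * g (2 * π * (j + 1) / n) < 0) →
      ∃ x ∈ Set.Ioo (2 * π * j / n) (2 * π * (j + 1) / n), g x = 0 := by
    intro j hj
    refine exists_zero_of_mul_neg hg ?_ (Finset.mem_filter.1 hj).2
    gcongr
    linarith
  choose! x hx hx0 using hz
  rw [signChanges, ← Set.ncard_coe_finset]
  refine Set.ncard_le_ncard_of_injOn x ?_ ?_ hfin
  · intro j hj
    have hjn := Finset.mem_range.1 (Finset.mem_filter.1 hj).1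
    have hn : (0 : ℝ) < n := by exact_mod_cast (Nat.zero_le j).trans_lt hjn
    have hjn' : (j : ℝ) + 1 ≤ n := by exact_mod_cast hjn
    refine ⟨⟨le_trans (by positivity) (hx j hj).1.le, (hx j hj).2.trans_le ?_⟩, hx0 j hj⟩
    rw [div_le_iff₀ hn]
    gcongr
  · intro i hi j hj hij
    have hin := Finset.mem_range.1 (Finset.mem_filter.1 hi).1
    have hn : (0 : ℝ) < n := by exact_mod_cast (Nat.zero_le i).trans_lt hin
    have h1 := (hx i hi).1.trans (hij ▸ (hx j hj).2)
    have h2 := (hx j hj).1.trans (hij ▸ (hx i hi).2)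
    rw [div_lt_div_iff_of_pos_right hn, mul_lt_mul_iff_right₀ (by positivity)] at h1 h2
    have h3 : i < j + 1 := by exact_mod_cast h1
    have h4 : j < i + 1 := by exact_mod_cast h2
    omega

/-- Once the mesh is smaller than every `δ θ`, the cell containing a zero has a sign change across
it, and no cell contains two zeros. -/
lemma eventually_le_signChanges {g : ℝ → ℝ} (hfin : (zeros g).Finite)
    (hsimple : ∀ θ ∈ zeros g, ∃ g' ≠ 0, HasDerivAt g g' θ)
    (hgrid : ∀ n j : ℕ, g (2 * π * j / n) ≠ 0) :
    ∀ᶠ n in atTop, (zeros g).ncard ≤ signChanges g n := by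
  have hπ := Real.pi_pos
  have hδ : ∀ θ ∈ zeros g, ∃ δ > 0, ∀ x y, θ - δ < x → x < θ → θ < y → y < θ + δ →
      g x * g y < 0 := by
    intro θ hθ
    obtain ⟨g', h1, h2⟩ := hsimple θ hθ
    exact exists_sign_change_of_hasDerivAt h2 h1 hθ.2
  choose! δ hδ0 hδ using hδ
  have hsmall : ∀ᶠ n : ℕ in atTop, ∀ θ ∈ zeros g, 2 * π / n < δ θ :=
    (eventually_all_finite hfin).2 fun θ hθ =>
      (tendsto_const_div_atTop_nhds_zero_nat (2 * π)).eventually_lt_const (hδ0 θ hθ)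
  filter_upwards [hsmall, eventually_gt_atTop 0] with n hn hn0
  have hn0' : (0 : ℝ) < n := by exact_mod_cast hn0
  have hloc : ∀ θ ∈ zeros g, 2 * π * (⌊θ * n / (2 * π)⌋₊ : ℕ) / n < θ ∧
      θ < 2 * π * ((⌊θ * n / (2 * π)⌋₊ : ℕ) + 1) / n := by
    intro θ hθ
    have h0 : 0 ≤ θ * n / (2 * π) := div_nonneg (mul_nonneg hθ.1.1 hn0'.le) (by positivity)
    constructor
    · refine lt_of_le_of_ne ?_ fun h => hgrid n _ (by rw [h]; exact hθ.2)
      have := Nat.floor_le h0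
      rw [le_div_iff₀ (by positivity)] at this
      rw [div_le_iff₀ hn0']
      linarith
    · have := Nat.lt_floor_add_one (θ * n / (2 * π))
      rw [div_lt_iff₀ (by positivity)] at this
      rw [lt_div_iff₀ hn0']
      linarith
  have hlen : ∀ j : ℕ, 2 * π * ((j : ℝ) + 1) / n = 2 * π * j / n + 2 * π / n := by
    intro j
    ring
  rw [signChanges, ← Set.ncard_coe_finset]
  refine Set.ncard_le_ncard_of_injOn (fun θ => ⌊θ * n / (2 * π)⌋₊) ?_ ?_ (Finset.finite_toSet _)
  · intro θ hθ
    obtain ⟨h1, h2⟩ := hloc θ hθ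
    have h3 := hn θ hθ
    have h4 := hlen ⌊θ * n / (2 * π)⌋₊
    rw [Finset.mem_coe, Finset.mem_filter, Finset.mem_range]
    refine ⟨?_, hδ θ hθ _ _ (by linarith) h1 h2 (by linarith)⟩
    rw [Nat.floor_lt (div_nonneg (mul_nonneg hθ.1.1 hn0'.le) (by positivity)),
      div_lt_iff₀ (by positivity), mul_comm]
    exact mul_lt_mul_of_pos_left hθ.1.2 hn0'
  · have aux : ∀ θ ∈ zeros g, ∀ η ∈ zeros g,
        ⌊θ * n / (2 * π)⌋₊ = ⌊η * n / (2 * π)⌋₊ → ¬ θ < η := by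
      intro θ hθ η hη heq hlt
      obtain ⟨h1, h2⟩ := hloc θ hθ
      obtain ⟨h1', h2'⟩ := hloc η hη
      have h3 := hn θ hθ
      have h4 := hlen ⌊θ * n / (2 * π)⌋₊
      rw [← heq] at h2'
      -- A second zero `η` in the cell would itself be a point where `g` must have a strict sign.
      have := hδ θ hθ _ η (by linarith) h1 hlt (by linarith)
      rw [hη.2, mul_zero] at this
      exact lt_irrefl _ this
    intro θ hθ η hη heq
    rcases lt_trichotomy θ η with h | h | h
    · exact absurd h (aux θ hθ η hη heq)
    · exact h
    · exact absurd h (aux η hη θ hθ heq.symm)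

/-! ### Real roots as zeros of a trigonometric polynomial in one period -/

lemma injOn_toUnits_exp :
    Set.InjOn (fun θ : ℝ => Circle.toUnits (Circle.exp θ)) (Set.Ico 0 (2 * π)) := by
  intro x hx y hy hxy
  have hπ := Real.pi_pos
  have h1 : Circle.exp x = Circle.exp y := Subtype.ext (congrArg Units.val hxy)
  obtain ⟨m, hm⟩ := Circle.exp_eq_exp.1 h1
  have h2 : (m : ℝ) < 1 := by
    by_contra! h
    nlinarith [hx.2, hy.1]
  have h3 : (-1 : ℝ) < m := by
    by_contra! h
    nlinarith [hx.1, hy.2]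
  have h4 : m < 1 := by exact_mod_cast h2
  have h5 : -1 < m := by exact_mod_cast h3
  have h6 : m = 0 := by omega
  rw [hm, h6]
  simp

lemma image_zeros_trig (P : realLaurent Λ) :
    (fun θ : ℝ => Circle.toUnits (Circle.exp θ)) '' zeros (trig P) =
      realRoots (P : ℂ[T;T⁻¹]) := by
  ext z
  constructor
  · rintro ⟨θ, hθ, rfl⟩
    refine ⟨?_, by simp⟩
    have := ofReal_trig P θ
    rw [hθ.2, Complex.ofReal_zero] at this
    exact this.symm
  · rintro ⟨hz, hz1⟩
    let w : Circle := ⟨z, mem_sphere_zero_iff_norm.2 hz1⟩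
    have hw : Circle.toUnits w = z := Units.ext rfl
    have hexp : Circle.exp (toIcoMod Real.two_pi_pos 0 (Complex.arg w)) = w := by
      rw [toIcoMod, Circle.periodic_exp.sub_zsmul_eq, Circle.exp_arg]
    refine ⟨toIcoMod Real.two_pi_pos 0 (Complex.arg w), ⟨?_, ?_⟩, ?_⟩
    · simpa using toIcoMod_mem_Ico Real.two_pi_pos 0 (Complex.arg w)
    · rw [trig, hexp, hw]
      have hz' : value P z = 0 := hz
      rw [hz', Complex.zero_re]
    · simp only [hexp, hw]

lemma ncard_realRoots (P : realLaurent Λ) :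
    (realRoots (P : ℂ[T;T⁻¹])).ncard = (zeros (trig P)).ncard := by
  rw [← image_zeros_trig]
  exact (injOn_toUnits_exp.mono fun θ hθ => hθ.1).ncard_image

lemma finite_zeros_trig {P : realLaurent Λ} (h : (roots (P : ℂ[T;T⁻¹])).Finite) :
    (zeros (trig P)).Finite := by
  refine Set.Finite.of_finite_image ?_ (injOn_toUnits_exp.mono fun θ hθ => hθ.1)
  rw [image_zeros_trig]
  exact h.subset fun z hz => hz.1

/-- Differentiate `trig P x = e^{-idx} p(e^{ix})` with `p = poly P`: at a root only the term with
`p'` remains, and it is nonzero because the root is simple. -/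
lemma exists_hasDerivAt_trig_ne_zero {P : realLaurent Λ} (hmult : P ∉ multipleRoot Λ) {θ : ℝ}
    (hθ : trig P θ = 0) : ∃ g' ≠ 0, HasDerivAt (trig P) g' θ := by
  set e : ℝ → ℂ := fun θ => Complex.exp (θ * Complex.I) with he
  have he' : HasDerivAt e (e θ * Complex.I) θ := by
    have h1 : HasDerivAt (fun x : ℝ => (x : ℂ) * Complex.I) (1 * Complex.I) θ :=
      Complex.ofRealCLM.hasDerivAt.mul_const _
    simpa using h1.cexp
  have he0 : ∀ x, e x ≠ 0 := fun x => Complex.exp_ne_zero _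
  have hpoly : ∀ x : ℝ, (poly P).eval (e x) = e x ^ degree Λ * (trig P x : ℂ) := by
    intro x
    have h := eval_poly P (Circle.toUnits (Circle.exp x))
    rw [← ofReal_trig, Circle.toUnits_apply, Units.val_mk0, Circle.coe_exp] at h
    exact h
  have htrig : (fun x => (trig P x : ℂ)) = fun x => (poly P).eval (e x) * (e x ^ degree Λ)⁻¹ := by
    ext x
    rw [hpoly, mul_comm, inv_mul_cancel_left₀ (pow_ne_zero _ (he0 x))]
  have hroot : (poly P).eval (e θ) = 0 := by rw [hpoly, hθ, Complex.ofReal_zero, mul_zero]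
  have hderiv : (poly P).derivative.eval (e θ) ≠ 0 := fun h => hmult ⟨e θ, hroot, h⟩
  have h1 : HasDerivAt (fun x => (poly P).eval (e x))
      ((poly P).derivative.eval (e θ) * (e θ * Complex.I)) θ :=
    ((poly P).hasDerivAt (e θ)).comp θ he'
  have h2 := h1.mul ((he'.pow (degree Λ)).inv (pow_ne_zero _ (he0 θ)))
  rw [hroot, zero_mul, add_zero] at h2
  set c := (poly P).derivative.eval (e θ) * (e θ * Complex.I) * (e ^ degree Λ)⁻¹ θ with hc
  have h3 : HasDerivAt (fun x => (trig P x : ℂ)) c θ := by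
    rw [htrig]
    exact h2
  have hc0 : c ≠ 0 := mul_ne_zero (mul_ne_zero hderiv (mul_ne_zero (he0 θ) Complex.I_ne_zero))
    (inv_ne_zero (pow_ne_zero _ (he0 θ)))
  have hre : HasDerivAt (trig P) c.re θ := by
    have := Complex.reCLM.hasFDerivAt.comp_hasDerivAt θ h3
    exact this
  -- The function is real-valued, so its complex derivative `c` is real and `c ≠ 0` gives `c.re ≠
  -- 0`.
  have him : HasDerivAt (fun _ : ℝ => (0 : ℝ)) c.im θ := by
    have := Complex.imCLM.hasFDerivAt.comp_hasDerivAt θ h3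
    exact this
  have him0 : c.im = 0 := him.unique (hasDerivAt_const θ 0)
  exact ⟨c.re, fun h => hc0 (Complex.ext h him0), hre⟩

/-! ### Expected sign changes and the passage to the limit -/

instance isProbabilityMeasure_law : IsProbabilityMeasure (law Λ) :=
  inferInstanceAs (IsProbabilityMeasure (stdGaussian (realLaurent Λ)))

/-- Almost surely the number of roots is twice the degree. -/
lemma ae_ncard_roots (hne : Λ.Nonempty) (hsymm : ∀ l ∈ Λ, -l ∈ Λ) :
    ∀ᵐ P : realLaurent Λ ∂(law Λ), (roots (P : ℂ[T;T⁻¹])).Finite ∧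
      (roots (P : ℂ[T;T⁻¹])).ncard = 2 * degree Λ := by
  have h1 := measure_eq_zero_iff_ae_notMem.1 (law_multipleRoot hne hsymm)
  have h2 := measure_eq_zero_iff_ae_notMem.1
    (law_coeff_eq_zero hne hsymm (m := degree Λ) (by simp))
  have h3 := measure_eq_zero_iff_ae_notMem.1
    (law_coeff_eq_zero hne hsymm (m := -degree Λ) (by simp))
  filter_upwards [h1, h2, h3] with P h1 h2 h3
  exact ncard_roots h1 h2 h3

lemma ae_tendsto_signChanges (hne : Λ.Nonempty) (hsymm : ∀ l ∈ Λ, -l ∈ Λ) :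
    ∀ᵐ P : realLaurent Λ ∂(law Λ), Tendsto (fun n => (signChanges (trig P) n : ℝ)) atTop (𝓝 (numRealRoots P)) := by
  have h1 := measure_eq_zero_iff_ae_notMem.1 (law_multipleRoot hne hsymm)
  have h2 : ∀ᵐ P : realLaurent Λ ∂(law Λ), ∀ n j : ℕ, trig P (2 * π * j / n) ≠ 0 :=
    ae_all_iff.2 fun n => ae_all_iff.2 fun j =>
      measure_eq_zero_iff_ae_notMem.1 (law_trig_eq_zero hne hsymm (2 * π * j / n))
  filter_upwards [h1, h2, ae_ncard_roots hne hsymm] with P h1 h2 h3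
  have hfin := finite_zeros_trig h3.1
  refine tendsto_const_nhds.congr' ?_
  filter_upwards [eventually_le_signChanges hfin
    (fun θ hθ => exists_hasDerivAt_trig_ne_zero h1 hθ.2) h2] with n hn
  rw [numRealRoots, ncard_realRoots, hn.antisymm (signChanges_le (continuous_trig P) hfin n)]

lemma ae_signChanges_le (hne : Λ.Nonempty) (hsymm : ∀ l ∈ Λ, -l ∈ Λ) (n : ℕ) :
    ∀ᵐ P : realLaurent Λ ∂(law Λ), ‖(signChanges (trig P) n : ℝ)‖ ≤ 2 * degree Λ := by
  filter_upwards [ae_ncard_roots hne hsymm] with P hP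
  have h1 := signChanges_le (continuous_trig P) (finite_zeros_trig hP.1) n
  have h2 : (realRoots (P : ℂ[T;T⁻¹])).ncard ≤ (roots (P : ℂ[T;T⁻¹])).ncard :=
    Set.ncard_le_ncard (fun z hz => hz.1) hP.1
  rw [ncard_realRoots, hP.2] at h2
  rw [Real.norm_of_nonneg (Nat.cast_nonneg _)]
  exact_mod_cast h1.trans h2

lemma measurableSet_trig_mul_trig_neg (hsymm : ∀ l ∈ Λ, -l ∈ Λ) (s t : ℝ) :
    MeasurableSet {P : realLaurent Λ | trig P s * trig P t < 0} := by
  simp_rw [← inner_evalVec hsymm]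
  exact measurableSet_lt (by fun_prop) measurable_const

lemma signChanges_eq_sum_indicator (n : ℕ) :
    (fun P : realLaurent Λ => (signChanges (trig P) n : ℝ)) = fun P => ∑ j ∈ Finset.range n,
      {P : realLaurent Λ | trig P (2 * π * j / n) * trig P (2 * π * (j + 1) / n) < 0}.indicator
        (fun _ => (1 : ℝ)) P := by
  ext P
  rw [signChanges, Finset.card_filter]
  push_cast
  refine Finset.sum_congr rfl fun j _ => ?_
  rw [Set.indicator_apply]
  rfl

/-- Linearity of expectation: by stationarity all `n` cells have the same probability of a sign
change, that for points at distance `2π / n`. -/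
lemma integral_signChanges (hne : Λ.Nonempty) (hsymm : ∀ l ∈ Λ, -l ∈ Λ) (n : ℕ) :
    ∫ P : realLaurent Λ, (signChanges (trig P) n : ℝ) ∂(law Λ) =
      2 / π * (n * Real.arcsin √((1 / (Λ.card : ℝ)) * ∑ m ∈ Λ, Real.sin (m * π / n) ^ 2)) := by
  have hm := measurableSet_trig_mul_trig_neg hsymm
  rw [signChanges_eq_sum_indicator, integral_finsetSum _ fun j _ =>
    (integrable_const (1 : ℝ)).indicator (hm _ _)]
  have : ∀ j ∈ Finset.range n, ∫ P : realLaurent Λ,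
      {P : realLaurent Λ | trig P (2 * π * j / n) * trig P (2 * π * (j + 1) / n) < 0}.indicator
        (fun _ => (1 : ℝ)) P ∂(law Λ) =
      2 / π * Real.arcsin √((1 / (Λ.card : ℝ)) * ∑ m ∈ Λ, Real.sin (m * π / n) ^ 2) := by
    intro j _
    rw [integral_indicator_const _ (hm _ _), law_trig_mul_trig_neg hne hsymm, smul_eq_mul, mul_one,
      mul_div_right_comm]
    have h : ∀ m ∈ Λ, Real.sin (m * (2 * π * j / n - 2 * π * (j + 1) / n) / 2) ^ 2 =
        Real.sin (m * π / n) ^ 2 := by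
      intro m _
      rw [← neg_sq, ← Real.sin_neg]
      congr 2
      ring
    rw [Finset.sum_congr rfl h]
  rw [Finset.sum_congr rfl this, Finset.sum_const, Finset.card_range, nsmul_eq_mul]
  ring

lemma tendsto_integral_signChanges (Λ : Finset ℤ) :
    Tendsto (fun n : ℕ =>
      2 / π * (n * Real.arcsin √((1 / (Λ.card : ℝ)) * ∑ m ∈ Λ, Real.sin (m * π / n) ^ 2)))
      atTop (𝓝 (2 * √((1 / (Λ.card : ℝ)) * ∑ l ∈ Λ, (l : ℝ) ^ 2))) := by
  have hπ := Real.pi_pos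
  set s : ℕ → ℝ := fun n => √((1 / (Λ.card : ℝ)) * ∑ m ∈ Λ, Real.sin (m * π / n) ^ 2) with hs
  have hsin : ∀ a : ℝ, Tendsto (fun n : ℕ => n * Real.sin (a / n)) atTop (𝓝 a) := by
    intro a
    -- The derivative of `sin` at 0, read along the increments `a / n` rescaled by `n`.
    have h := ((Real.hasDerivAt_sin 0).hasFDerivAt).lim a (c := fun n : ℕ => (n : ℝ))
      (l := atTop) (tendsto_norm_atTop_atTop.comp tendsto_natCast_atTop_atTop)
    simpa [div_eq_inv_mul] using h
  have h1 : Tendsto (fun n : ℕ => n * s n) atTop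
      (𝓝 (π * √((1 / (Λ.card : ℝ)) * ∑ l ∈ Λ, (l : ℝ) ^ 2))) := by
    have h2 : Tendsto (fun n : ℕ => √((1 / (Λ.card : ℝ)) *
        ∑ m ∈ Λ, (n * Real.sin (m * π / n)) ^ 2)) atTop
        (𝓝 √((1 / (Λ.card : ℝ)) * ∑ m ∈ Λ, (m * π) ^ 2)) :=
      (Real.continuous_sqrt.tendsto _).comp
        ((tendsto_finsetSum _ fun m _ => (hsin _).pow 2).const_mul _)
    have h3 : ∀ r : ℝ, 0 ≤ r → ∀ x : ℤ → ℝ, r * √((1 / (Λ.card : ℝ)) * ∑ m ∈ Λ, x m ^ 2) =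
        √((1 / (Λ.card : ℝ)) * ∑ m ∈ Λ, (r * x m) ^ 2) := by
      intro r hr x
      simp_rw [mul_pow]
      rw [← Finset.mul_sum, mul_left_comm, Real.sqrt_mul (sq_nonneg r), Real.sqrt_sq hr]
    rw [h3 π hπ.le]
    simp_rw [hs, h3 _ (Nat.cast_nonneg _), mul_comm π]
    exact h2
  have h4 : Tendsto s atTop (𝓝 0) := by
    have := h1.mul tendsto_inv_atTop_nhds_zero_nat
    rw [mul_zero] at this
    refine this.congr' ?_
    filter_upwards [eventually_gt_atTop 0] with n hn
    have : (n : ℝ) ≠ 0 := by exact_mod_cast hn.ne'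
    field_simp
  have h5 : HasDerivAt Real.arcsin 1 0 := by
    simpa using Real.hasDerivAt_arcsin (x := 0) (by norm_num) (by norm_num)
  -- Since `arcsin` has derivative 1 at 0, `n * arcsin (s n)` has the same limit as `n * s n`.
  have h6 := h5.hasFDerivAt.hasFDerivWithinAt.lim (s := Set.univ) (c := fun n : ℕ => (n : ℝ))
    (d := s) h4 (Eventually.of_forall fun _ => Set.mem_univ _) h1
  have h7 := h6.const_mul (2 / π)
  simp only [zero_add, Real.arcsin_zero, sub_zero, smul_eq_mul] at h7
  convert h7 using 2
  simp
  field_simp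

lemma aestronglyMeasurable_numRealRoots (hne : Λ.Nonempty) (hsymm : ∀ l ∈ Λ, -l ∈ Λ) :
    AEStronglyMeasurable (fun P : realLaurent Λ => numRealRoots P) (law Λ) := by
  refine aestronglyMeasurable_of_tendsto_ae atTop (fun n => ?_) (ae_tendsto_signChanges hne hsymm)
  rw [signChanges_eq_sum_indicator]
  exact (Finset.measurable_fun_sum _ fun j _ => measurable_const.indicator
    (measurableSet_trig_mul_trig_neg hsymm _ _)).aestronglyMeasurable

lemma integrable_numRealRoots (hne : Λ.Nonempty) (hsymm : ∀ l ∈ Λ, -l ∈ Λ) :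
    Integrable (fun P : realLaurent Λ => numRealRoots P) (law Λ) := by
  refine Integrable.of_bound (aestronglyMeasurable_numRealRoots hne hsymm) (2 * degree Λ) ?_
  filter_upwards [ae_tendsto_signChanges hne hsymm,
    ae_all_iff.2 (ae_signChanges_le hne hsymm)] with P h1 h2
  exact le_of_tendsto h1.norm (Eventually.of_forall h2)

lemma integral_numRealRoots (hne : Λ.Nonempty) (hsymm : ∀ l ∈ Λ, -l ∈ Λ) :
    ∫ P : realLaurent Λ, numRealRoots P ∂(law Λ) =
      2 * √((1 / (Λ.card : ℝ)) * ∑ l ∈ Λ, (l : ℝ) ^ 2) := by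
  have h := tendsto_integral_of_dominated_convergence (μ := law Λ)
    (F := fun n (P : realLaurent Λ) => (signChanges (trig P) n : ℝ)) (f := numRealRoots)
    (fun _ => 2 * (degree Λ : ℝ)) (fun n => by
      rw [signChanges_eq_sum_indicator]
      exact (Finset.measurable_fun_sum _ fun j _ => measurable_const.indicator
        (measurableSet_trig_mul_trig_neg hsymm _ _)).aestronglyMeasurable)
    (integrable_const _) (ae_signChanges_le hne hsymm) (ae_tendsto_signChanges hne hsymm)
  simp_rw [integral_signChanges hne hsymm] at h
  exact tendsto_nhds_unique h (tendsto_integral_signChanges Λ)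

/-- The denominator is almost surely the constant `2 * degree Λ`. In degree 0 both sides are 0, by
the convention for division by zero. -/
lemma probRootReal_eq (hne : Λ.Nonempty) (hsymm : ∀ l ∈ Λ, -l ∈ Λ) :
    probRootReal Λ =
      (1 / (degree Λ : ℝ)) * √((1 / (Λ.card : ℝ)) * ∑ l ∈ Λ, (l : ℝ) ^ 2) := by
  have h : ∫ P : realLaurent Λ, numRealRoots P / ((roots (P : ℂ[T;T⁻¹])).ncard : ℝ) ∂(law Λ) =
      ∫ P : realLaurent Λ, numRealRoots P / (2 * degree Λ : ℝ) ∂(law Λ) := by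
    refine integral_congr_ae ?_
    filter_upwards [ae_ncard_roots hne hsymm] with P hP
    rw [hP.2]
    push_cast
    rfl
  rw [probRootReal, h, integral_div, integral_numRealRoots hne hsymm,
    mul_div_mul_left _ _ two_ne_zero]
  ring

/-! ### Invariance under dilation of the spectrum -/

lemma degree_image_mul (Λ : Finset ℤ) (k : ℤ) :
    degree (Λ.image fun l => k * l) = k.natAbs * degree Λ := by
  rw [degree, degree, Finset.sup_image, Finset.mul_sup₀]
  exact Finset.sup_congr rfl fun l _ => Int.natAbs_mul k l

/-- Both the degree and the root mean square of the spectrum scale by `|k|`, which cancels. -/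
lemma probRootReal_image_mul (hne : Λ.Nonempty) (hsymm : ∀ l ∈ Λ, -l ∈ Λ) {k : ℤ} (hk : k ≠ 0) :
    probRootReal (Λ.image fun l => k * l) = probRootReal Λ := by
  have hinj : Function.Injective fun l : ℤ => k * l := mul_right_injective₀ hk
  have hk' : |(k : ℝ)| ≠ 0 := abs_ne_zero.2 (Int.cast_ne_zero.2 hk)
  have hsymm' : ∀ l ∈ Λ.image fun l => k * l, -l ∈ Λ.image fun l => k * l := by
    intro l hl
    obtain ⟨m, hm, rfl⟩ := Finset.mem_image.1 hl
    exact Finset.mem_image.2 ⟨-m, hsymm m hm, mul_neg k m⟩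
  rw [probRootReal_eq (hne.image _) hsymm', probRootReal_eq hne hsymm, degree_image_mul,
    Finset.card_image_of_injective _ hinj, Finset.sum_image hinj.injOn]
  push_cast
  simp_rw [mul_pow]
  rw [← Finset.mul_sum, mul_left_comm, Real.sqrt_mul (sq_nonneg _), Real.sqrt_sq_eq_abs,
    Nat.cast_natAbs, Int.cast_abs, ← mul_assoc]
  congr 1
  rw [one_div, mul_inv, mul_right_comm, inv_mul_cancel₀ hk', one_mul, one_div]

end RandomLaurent

end

theorem theorem3 (Λ : Finset ℤ) (hne : Λ.Nonempty) (hsymm : ∀ l ∈ Λ, -l ∈ Λ) :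
    (Integrable (fun P : RandomLaurent.realLaurent Λ => RandomLaurent.numRealRoots P)
        (RandomLaurent.law Λ) ∧
      ∫ P : RandomLaurent.realLaurent Λ, RandomLaurent.numRealRoots P ∂(RandomLaurent.law Λ) =
        2 * √((1 / (Λ.card : ℝ)) * ∑ l ∈ Λ, (l : ℝ) ^ 2)) ∧
    (Λ ≠ {0} →
      RandomLaurent.probRootReal Λ =
        (1 / (RandomLaurent.degree Λ : ℝ)) * √((1 / (Λ.card : ℝ)) * ∑ l ∈ Λ, (l : ℝ) ^ 2)) ∧
    (Λ ≠ {0} → ∀ k : ℤ, k ≠ 0 →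
      RandomLaurent.probRootReal (Λ.image (fun l => k * l)) = RandomLaurent.probRootReal Λ) :=
  ⟨⟨RandomLaurent.integrable_numRealRoots hne hsymm,
      RandomLaurent.integral_numRealRoots hne hsymm⟩,
    fun _ => RandomLaurent.probRootReal_eq hne hsymm,
    fun _ _ hk => RandomLaurent.probRootReal_image_mul hne hsymm hk⟩
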